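/- **Min-max equality for the CVaR over multi-transport hyperrectangles.** Let $(E_k,\rho_k)$, $k=1,\dots,n$, be proper metric spaces, let $\Xi\subset E_1\times\cdots\times E_n$ be closed (for instance the whole product, or a closed subset of $\mathbb R^d=\mathbb R^{d_1}\times\cdots\times\mathbb R^{d_n}$), and let $\rho$ be a metric on $\Xi$ that is equivalent to the product metric $(\sum_{k=1}^n\rho_k^q)^{1/q}$ for some $q\in[1,\infty]$, i.e. each is bounded by a positive multiple of the other. Let $p\ge 1$, let $Q$ be a Borel probability measure on $\Xi$ with finite $p$th moment $\int_\Xi\rho(\zeta,\xi)^p\,dQ(\xi)<\infty$ for some $\zeta\in\Xi$, and let $\varepsilon=(\varepsilon_1,\dots,\varepsilon_n)$ with $\varepsilon_k\ge 0$. Let $\mathcal T_p(Q,\varepsilon)$ be the set of second marginals of the probability measures $\pi$ on $\Xi\times\Xi$ whose first marginal is $Q$ and which satisfy $$\int_{\Xi\times\Xi}\rho_k(\zeta_k,\xi_k)^p\,d\pi(\zeta,\xi)\le\varepsilon_k^p\qquad\text{for all }k=1,\dots,n.$$ Let $\alpha\in(0,1)$, let $\mathcal X\subset\mathbb R^\ell$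 be closed and convex, and let $f:\mathcal X\times\Xi\to\mathbb R$ be such that $x\mapsto f(x,\xi)$ is convex on $\mathcal X$ for every $\xi\in\Xi$, and such that there is $r\in[0,p)$ for which, for every $x\in\mathcal X$, the function $\xi\mapsto f(x,\xi)$ is continuous and both $h=f(x,\cdot)$ and $h=-f(x,\cdot)$ satisfy $h(\xi)\le C(1+\rho(\zeta,\xi)^r)$ for all $\xi\in\Xi$, for some $C>0$ and $\zeta\in\Xi$. Write $y_+=\max\{y,0\}$. Then, for every $x\in\mathcal X$, the function $\xi\mapsto(f(x,\xi)+\tau)_+-\tau\alpha$ is $P$-integrable for all $P\in\mathcal T_p(Q,\varepsilon)$ and $\tau\in\mathbb R$, and: (i) both sides of the following equality are finite and $$\sup_{P\in\mathcal T_p(Q,\varepsilon)}\inf_{\tau\in\mathbb R}\mathbb E_P\big[(f(x,\xi)+\tau)_+-\tau\alpha\big]=\inf_{\tau\in\mathbb R}\sup_{P\in\mathcal T_p(Q,\varepsilon)}\mathbb E_P\big[(f(x,\xi)+\tau)_+-\tau\alpha\big];$$ (ii) the infimum over $\tau$ on the right-hand side is attained. -/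

import Mathlib

open MeasureTheory
open scoped ENNReal

namespace MTH

/-- `ρ` is a metric on `X`. -/
structure IsMetric {X : Type*} (ρ : X → X → ℝ) : Prop where
  eq_zero_iff : ∀ a b, ρ a b = 0 ↔ a = b
  symm : ∀ a b, ρ a b = ρ b a
  triangle : ∀ a b c, ρ a c ≤ ρ a b + ρ b c

/-- The product metric `(∑ₖ ρₖ ^ q) ^ (1 / q)` (the maximum of the `ρₖ` when `q = ∞`) on
`E₁ × ⋯ × Eₙ`, where `ρₖ` is the distance of `Eₖ`. -/
noncomputable def productDist {n : ℕ} {E : Fin n → Type*} [∀ k, MetricSpace (E k)] (q : ℝ≥0∞)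
    (a b : ∀ k, E k) : ℝ :=
  dist (WithLp.toLp q a : PiLp q E) (WithLp.toLp q b)

/-- The metric `ρ` on the subset `Ξ` of `E₁ × ⋯ × Eₙ` is equivalent to the product metric with
some exponent `q ∈ [1, ∞]`: each is bounded by a positive multiple of the other. -/
def EquivProductDist {n : ℕ} {E : Fin n → Type*} [∀ k, MetricSpace (E k)]
    {Ξ : Set (∀ k, E k)} (ρ : Ξ → Ξ → ℝ) : Prop :=
  ∃ q : ℝ≥0∞, 1 ≤ q ∧ ∃ c C : ℝ, 0 < c ∧ 0 < C ∧ ∀ a b : Ξ,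
    c * productDist q a.1 b.1 ≤ ρ a b ∧ ρ a b ≤ C * productDist q a.1 b.1

/-- The upper growth bound of order `r` with respect to `ρ`. -/
def GrowthUp {X : Type*} (ρ : X → X → ℝ) (r : ℝ) (h : X → ℝ) : Prop :=
  ∃ C : ℝ, 0 < C ∧ ∃ ζ : X, ∀ ξ : X, h ξ ≤ C * (1 + ρ ζ ξ ^ r)

/-- The class of functions with two-sided growth of order `r` with respect to `ρ`. -/
def Growth {X : Type*} (ρ : X → X → ℝ) (r : ℝ) (h : X → ℝ) : Prop :=
  GrowthUp ρ r h ∧ GrowthUp ρ r (fun ξ => -h ξ)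

/-- The measure `Q` has a finite `p`th moment with respect to `ρ`. -/
def FiniteMoment {X : Type*} [MeasurableSpace X] (ρ : X → X → ℝ) (p : ℝ) (Q : Measure X) : Prop :=
  ∃ ζ : X, ∫⁻ ξ, ENNReal.ofReal (ρ ζ ξ ^ p) ∂Q < ∞

/-- The class of constraint functions `f : 𝒳 × Ξ → ℝ`: convex in the decision variable and, for
some order `r ∈ [0, p)` that does not depend on `x`, continuous with two-sided growth of order `r`
in the uncertainty. -/
structure IsConstraintFunction {V X : Type*} [AddCommGroup V] [Module ℝ V] [TopologicalSpace X]
    (𝒳 : Set V) (ρ : X → X → ℝ) (p : ℝ) (f : V → X → ℝ) : Prop where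
  convex : ∀ ξ, ConvexOn ℝ 𝒳 (fun x => f x ξ)
  growth : ∃ r : ℝ, 0 ≤ r ∧ r < p ∧ ∀ x ∈ 𝒳, Continuous (f x) ∧ Growth ρ r (f x)

/-- The multi-transport hyperrectangle `𝒯_p(Q, ε)` on `Ξ ⊆ E₁ × ⋯ × Eₙ`: the second marginals of
the probability measures on `Ξ × Ξ` with first marginal `Q` and transport cost at most `εₖ ^ p` in
each component `k`. -/
def hyperrectangle {n : ℕ} {E : Fin n → Type*} [∀ k, MetricSpace (E k)]
    [∀ k, MeasurableSpace (E k)] {Ξ : Set (∀ k, E k)} (p : ℝ) (Q : Measure Ξ) (ε : Fin n → ℝ) :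
    Set (Measure Ξ) :=
  {P | ∃ π : Measure (Ξ × Ξ), IsProbabilityMeasure π ∧ π.map Prod.fst = Q ∧ π.map Prod.snd = P ∧
    ∀ k, ∫⁻ z, ENNReal.ofReal (dist (z.1.1 k) (z.2.1 k) ^ p) ∂π ≤ ENNReal.ofReal (ε k ^ p)}

/-- `E_P[(h(ξ) + τ)₊ - τ α]`. -/
noncomputable def cvarObjective {X : Type*} [MeasurableSpace X] (h : X → ℝ) (α τ : ℝ)
    (P : Measure X) : ℝ :=
  ∫ ξ, (max (h ξ + τ) 0 - τ * α) ∂P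

end MTH

namespace MTH

/-! The objective is affine in `P` and convex in `τ`, so Sion's theorem applies once `τ` is confined
to a compact interval; the hyperrectangle only has to be convex, not compact. Measures enter through
the functions `τ ↦ cvarObjective (f x) α τ P` in `ℝ → ℝ`, so no topology on measures is needed. The
confinement comes from one constant `B` bounding `E_P|f x|` over the whole hyperrectangle
(`exists_integral_abs_le`): the objective is at most `B` at `τ = 0`, and at least `-τα` and `τ(1 -
α) - B` everywhere. Outside an interval independent of `P` it therefore exceeds its value at `0`, so
restricting `τ` changes neither infimum. Attainment follows since a supremum of continuous functions
is lower semicontinuous. -/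

/-- Minimax over the real line for a convex family of convex functions that is uniformly coercive:
outside `[-M, M]` every member is at least its value at `0`. -/
theorem minimax_of_coercive {Y : Set (ℝ → ℝ)} (hY : Convex ℝ Y)
    (hconv : ∀ g ∈ Y, ConvexOn ℝ Set.univ g) {M : ℝ} (hM : 0 ≤ M)
    (hcoer : ∀ g ∈ Y, ∀ τ, τ ∉ Set.Icc (-M) M → g 0 ≤ g τ) :
    (⨆ g ∈ Y, ⨅ τ : ℝ, (g τ : EReal)) = (⨅ τ : ℝ, ⨆ g ∈ Y, (g τ : EReal)) ∧
    ∃ τ₀ : ℝ, (⨆ g ∈ Y, (g τ₀ : EReal)) = ⨅ τ : ℝ, ⨆ g ∈ Y, (g τ : EReal) := by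
  have h0 : (0 : ℝ) ∈ Set.Icc (-M) M := ⟨by linarith, hM⟩
  have hlsc : ∀ g ∈ Y, LowerSemicontinuousOn (fun τ : ℝ => (g τ : EReal)) (Set.Icc (-M) M) := by
    intro g hg
    have hc : Continuous g :=
      continuousOn_univ.1 (ConvexOn.continuousOn isOpen_univ (hconv g hg))
    exact (continuous_coe_real_ereal.comp hc).continuousOn.lowerSemicontinuousOn
  have hqc : ∀ g ∈ Y, QuasiconvexOn ℝ (Set.Icc (-M) M) (fun τ : ℝ => (g τ : EReal)) := by
    intro g hg
    exact QuasiconvexOn.monotone_comp (g := Real.toEReal) EReal.coe_strictMono.monotone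
      ((hconv g hg).subset (Set.subset_univ _) (convex_Icc _ _)).quasiconvexOn
  -- `Y` carries the product topology, in which evaluation at `τ` is continuous and linear.
  have husc : ∀ τ ∈ Set.Icc (-M) M,
      UpperSemicontinuousOn (fun g : ℝ → ℝ => (g τ : EReal)) Y := fun τ _ =>
    (continuous_coe_real_ereal.comp (continuous_apply τ)).continuousOn.upperSemicontinuousOn
  have hqcc : ∀ τ ∈ Set.Icc (-M) M, QuasiconcaveOn ℝ Y (fun g : ℝ → ℝ => (g τ : EReal)) := by
    intro τ _
    exact QuasiconcaveOn.monotone_comp (g := Real.toEReal) EReal.coe_strictMono.monotone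
      (LinearMap.concaveOn (LinearMap.proj (R := ℝ) (φ := fun _ : ℝ => ℝ) τ) hY).quasiconcaveOn
  have hsion := Sion.minimax' (f := fun (τ : ℝ) (g : ℝ → ℝ) => (g τ : EReal)) ⟨0, h0⟩
    (convex_Icc (-M) M) isCompact_Icc hlsc hqc hY husc hqcc
  -- Used both for each single `g` and for the supremum over `Y`, which inherits coercivity.
  have hinf : ∀ F : ℝ → EReal, (∀ τ, τ ∉ Set.Icc (-M) M → F 0 ≤ F τ) →
      ⨅ τ ∈ Set.Icc (-M) M, F τ = ⨅ τ, F τ := by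
    intro F hF
    refine le_antisymm (le_iInf fun τ => ?_) (le_iInf₂ fun τ _ => iInf_le _ τ)
    by_cases hτ : τ ∈ Set.Icc (-M) M
    · exact iInf₂_le τ hτ
    · exact (iInf₂_le (0 : ℝ) h0).trans (hF τ hτ)
  have hsup : ⨅ τ ∈ Set.Icc (-M) M, (⨆ g ∈ Y, (g τ : EReal)) = ⨅ τ : ℝ, ⨆ g ∈ Y, (g τ : EReal) :=
    hinf _ fun τ hτ => iSup₂_mono fun g hg => EReal.coe_le_coe_iff.2 (hcoer g hg τ hτ)
  refine ⟨?_, ?_⟩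
  · rw [← hsup, hsion]
    exact iSup_congr fun g => iSup_congr fun hg =>
      (hinf (fun τ => (g τ : EReal)) fun τ hτ => EReal.coe_le_coe_iff.2 (hcoer g hg τ hτ)).symm
  · have hl : LowerSemicontinuousOn (fun τ : ℝ => ⨆ g ∈ Y, (g τ : EReal)) (Set.Icc (-M) M) :=
      fun τ hτ => lowerSemicontinuousWithinAt_iSup fun g =>
        lowerSemicontinuousWithinAt_iSup fun hg => hlsc g hg τ hτ
    obtain ⟨τ₀, hτ₀, hmin⟩ := hl.exists_isMinOn ⟨0, h0⟩ isCompact_Icc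
    exact ⟨τ₀, le_antisymm (hsup ▸ le_iInf₂ fun τ hτ => hmin hτ) (iInf_le _ τ₀)⟩

theorem rpow_add_le {a b p : ℝ} (ha : 0 ≤ a) (hb : 0 ≤ b) (hp : 0 ≤ p) :
    (a + b) ^ p ≤ 2 ^ p * (a ^ p + b ^ p) := by
  have key : ∀ {x y : ℝ}, 0 ≤ x → x ≤ y → (x + y) ^ p ≤ 2 ^ p * (x ^ p + y ^ p) := by
    intro x y hx hxy
    calc (x + y) ^ p ≤ (2 * y) ^ p := Real.rpow_le_rpow (by linarith) (by linarith) hp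
      _ = 2 ^ p * y ^ p := Real.mul_rpow (by norm_num) (hx.trans hxy)
      _ ≤ _ := by
        gcongr
        linarith [Real.rpow_nonneg hx p]
  rcases le_total a b with h | h
  · exact key ha h
  · rw [add_comm a b, add_comm (a ^ p)]
    exact key hb h

theorem rpow_le_one_add_rpow {t r p : ℝ} (ht : 0 ≤ t) (hr : 0 ≤ r) (hrp : r ≤ p) :
    t ^ r ≤ 1 + t ^ p := by
  rcases le_total t 1 with h | h
  · linarith [Real.rpow_le_one ht h hr, Real.rpow_nonneg ht p]
  · linarith [Real.rpow_le_rpow_of_exponent_le h hrp]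

/-! ### Metric comparison, moments and couplings. -/

section Transport

variable {n : ℕ} {E : Fin n → Type*} [∀ k, MetricSpace (E k)] {Ξ : Set (∀ k, E k)}

/-- Here `dist` is the sup metric inherited from the pi type; it is within a factor `n ^ (1 / q)` of
the `q`-product metric. -/
theorem EquivProductDist.exists_dist_bounds {ρ : Ξ → Ξ → ℝ} (h : EquivProductDist ρ) :
    ∃ c C : ℝ, 0 < c ∧ 0 ≤ C ∧ ∀ a b : Ξ, c * dist a b ≤ ρ a b ∧ ρ a b ≤ C * dist a b := by
  obtain ⟨q, hq, c, C, hc, hC, hb⟩ := h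
  have : Fact (1 ≤ q) := ⟨hq⟩
  refine ⟨c, C * ((Fintype.card (Fin n) : NNReal) ^ (1 / q).toReal : NNReal), hc, by positivity,
    fun a b => ⟨?_, ?_⟩⟩
  · refine le_trans ?_ (hb a b).1
    have h1 : dist a b ≤ productDist q a.1 b.1 := by
      simpa [productDist, Subtype.dist_eq] using
        (PiLp.lipschitzWith_ofLp q E).dist_le_mul (WithLp.toLp q a.1) (WithLp.toLp q b.1)
    gcongr
  · refine (hb a b).2.trans ?_
    rw [mul_assoc]
    have h1 := (PiLp.antilipschitzWith_ofLp q E).le_mul_dist (WithLp.toLp q a.1)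
      (WithLp.toLp q b.1)
    exact mul_le_mul_of_nonneg_left h1 hC.le

theorem GrowthUp.exists_dist_bound {ρ : Ξ → Ξ → ℝ} (hρE : EquivProductDist ρ) {r p : ℝ}
    (hr : 0 ≤ r) (hrp : r ≤ p) {h : Ξ → ℝ} (hh : GrowthUp ρ r h) (ζ₀ : Ξ) :
    ∃ A : ℝ, 0 ≤ A ∧ ∀ ξ, h ξ ≤ A * (1 + dist ζ₀ ξ ^ p) := by
  obtain ⟨c, C, hc, hC, hb⟩ := hρE.exists_dist_bounds
  obtain ⟨D, hD, ζ, hζ⟩ := hh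
  have hp : 0 ≤ p := hr.trans hrp
  have hK : 0 ≤ C ^ p * 2 ^ p := by positivity
  have hd : 0 ≤ dist ζ ζ₀ ^ p := by positivity
  -- With `K = C ^ p * 2 ^ p`, `d = dist ζ ζ₀ ^ p` and `y = dist ζ₀ ξ ^ p`: `1 + ρ ^ r ≤ 2 + ρ ^ p ≤
  -- 2 + K(d + y) ≤ (2 + K(d + 1))(1 + y)`.
  refine ⟨D * (2 + C ^ p * 2 ^ p * (dist ζ ζ₀ ^ p + 1)), by positivity, fun ξ => ?_⟩
  refine (hζ ξ).trans ?_
  have hρ0 : 0 ≤ ρ ζ ξ := le_trans (by positivity) (hb ζ ξ).1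
  have h1 : ρ ζ ξ ^ p ≤ C ^ p * 2 ^ p * (dist ζ ζ₀ ^ p + dist ζ₀ ξ ^ p) := by
    calc ρ ζ ξ ^ p ≤ (C * (dist ζ ζ₀ + dist ζ₀ ξ)) ^ p :=
          Real.rpow_le_rpow hρ0 ((hb ζ ξ).2.trans
            (mul_le_mul_of_nonneg_left (dist_triangle _ _ _) hC)) hp
      _ = C ^ p * (dist ζ ζ₀ + dist ζ₀ ξ) ^ p := Real.mul_rpow hC (by positivity)
      _ ≤ C ^ p * (2 ^ p * (dist ζ ζ₀ ^ p + dist ζ₀ ξ ^ p)) :=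
          mul_le_mul_of_nonneg_left (rpow_add_le dist_nonneg dist_nonneg hp) (by positivity)
      _ = _ := by ring
  have h2 := rpow_le_one_add_rpow hρ0 hr hrp
  have hd2 : 0 ≤ dist ζ₀ ξ ^ p := by positivity
  rw [mul_assoc D]
  refine mul_le_mul_of_nonneg_left ?_ hD.le
  nlinarith [mul_nonneg hK hd, mul_nonneg hK hd2, mul_nonneg (mul_nonneg hK hd) hd2]

theorem Growth.exists_dist_bound {ρ : Ξ → Ξ → ℝ} (hρE : EquivProductDist ρ) {r p : ℝ}
    (hr : 0 ≤ r) (hrp : r ≤ p) {h : Ξ → ℝ} (hh : Growth ρ r h) (ζ₀ : Ξ) :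
    ∃ A : ℝ, 0 ≤ A ∧ ∀ ξ, |h ξ| ≤ A * (1 + dist ζ₀ ξ ^ p) := by
  obtain ⟨A, hA, h1⟩ := hh.1.exists_dist_bound hρE hr hrp ζ₀
  obtain ⟨B, hB, h2⟩ := hh.2.exists_dist_bound hρE hr hrp ζ₀
  refine ⟨A + B, by positivity, fun ξ => abs_le'.2 ?_⟩
  have h3 : 0 ≤ 1 + dist ζ₀ ξ ^ p := by positivity
  constructor
  · nlinarith [h1 ξ, mul_nonneg hB h3]
  · nlinarith [h2 ξ, mul_nonneg hA h3]

theorem dist_rpow_le_sum {p : ℝ} (hp : 0 < p) (a b : Ξ) :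
    dist a b ^ p ≤ ∑ k, dist (a.1 k) (b.1 k) ^ p := by
  have hs : 0 ≤ ∑ k, dist (a.1 k) (b.1 k) ^ p := Finset.sum_nonneg fun k _ => by positivity
  rw [← Real.le_rpow_inv_iff_of_pos dist_nonneg hs hp, Subtype.dist_eq,
    dist_pi_le_iff (by positivity)]
  intro k
  rw [Real.le_rpow_inv_iff_of_pos dist_nonneg hs hp]
  exact Finset.single_le_sum (f := fun k => dist (a.1 k) (b.1 k) ^ p)
    (fun k _ => by positivity) (Finset.mem_univ k)

variable [∀ k, MeasurableSpace (E k)]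

theorem FiniteMoment.dist {ρ : Ξ → Ξ → ℝ} (hρE : EquivProductDist ρ) {p : ℝ} (hp : 0 ≤ p)
    {Q : Measure Ξ} (hQ : FiniteMoment ρ p Q) : FiniteMoment (fun a b : Ξ => dist a b) p Q := by
  obtain ⟨c, C, hc, hC, hb⟩ := hρE.exists_dist_bounds
  obtain ⟨ζ, hζ⟩ := hQ
  refine ⟨ζ, ?_⟩
  calc ∫⁻ ξ, ENNReal.ofReal (Dist.dist ζ ξ ^ p) ∂Q
      ≤ ∫⁻ ξ, ENNReal.ofReal (c⁻¹ ^ p) * ENNReal.ofReal (ρ ζ ξ ^ p) ∂Q := by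
        refine lintegral_mono fun ξ => ?_
        have hρ0 : 0 ≤ ρ ζ ξ := le_trans (by positivity) (hb ζ ξ).1
        rw [← ENNReal.ofReal_mul (by positivity), ← Real.mul_rpow (by positivity) hρ0]
        refine ENNReal.ofReal_le_ofReal (Real.rpow_le_rpow dist_nonneg ?_ hp)
        rw [le_inv_mul_iff₀ hc]
        exact (hb ζ ξ).1
    _ = ENNReal.ofReal (c⁻¹ ^ p) * ∫⁻ ξ, ENNReal.ofReal (ρ ζ ξ ^ p) ∂Q :=
        lintegral_const_mul' _ _ ENNReal.ofReal_ne_top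
    _ < ∞ := ENNReal.mul_lt_top ENNReal.ofReal_lt_top hζ

theorem isProbabilityMeasure_of_mem_hyperrectangle {p : ℝ} {Q : Measure Ξ} {ε : Fin n → ℝ}
    {P : Measure Ξ} (hP : P ∈ hyperrectangle p Q ε) : IsProbabilityMeasure P := by
  obtain ⟨π, hπ, -, rfl, -⟩ := hP
  exact Measure.isProbabilityMeasure_map measurable_snd.aemeasurable

theorem self_mem_hyperrectangle {p : ℝ} (hp : 0 < p) {Q : Measure Ξ} [IsProbabilityMeasure Q]
    (ε : Fin n → ℝ) : Q ∈ hyperrectangle p Q ε := by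
  have hm : Measurable fun ξ : Ξ => (ξ, ξ) := measurable_id.prodMk measurable_id
  refine ⟨Q.map fun ξ => (ξ, ξ), Measure.isProbabilityMeasure_map hm.aemeasurable, ?_, ?_,
    fun k => ?_⟩
  · rw [Measure.map_map measurable_fst hm]
    exact Measure.map_id
  · rw [Measure.map_map measurable_snd hm]
    exact Measure.map_id
  -- The inequality form avoids measurability of the cost, as no Borel assumption is in force yet.
  · refine (lintegral_map_le _ _).trans ?_
    simp [Real.zero_rpow hp.ne']

/-- Mix the couplings: both marginals and all costs are linear in the coupling, and the first
marginal stays `Q`. -/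
theorem convexComb_mem_hyperrectangle {p : ℝ} {Q : Measure Ξ} [IsProbabilityMeasure Q]
    {ε : Fin n → ℝ} {P₁ P₂ : Measure Ξ} (h₁ : P₁ ∈ hyperrectangle p Q ε)
    (h₂ : P₂ ∈ hyperrectangle p Q ε) {s t : NNReal} (hst : s + t = 1) :
    s • P₁ + t • P₂ ∈ hyperrectangle p Q ε := by
  obtain ⟨π₁, hπ₁, hf₁, hs₁, hk₁⟩ := h₁
  obtain ⟨π₂, hπ₂, hf₂, hs₂, hk₂⟩ := h₂
  have hst' : (s : ℝ≥0∞) + t = 1 := by exact_mod_cast hst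
  refine ⟨s • π₁ + t • π₂, ⟨?_⟩, ?_, ?_, fun k => ?_⟩
  · rw [Measure.add_apply, Measure.smul_apply, Measure.smul_apply, measure_univ, measure_univ,
      ENNReal.smul_def, ENNReal.smul_def, smul_eq_mul, smul_eq_mul, mul_one, mul_one, hst']
  · rw [Measure.map_add _ _ measurable_fst, Measure.map_smul, Measure.map_smul, hf₁, hf₂,
      ← add_smul, hst, one_smul]
  · rw [Measure.map_add _ _ measurable_snd, Measure.map_smul, Measure.map_smul, hs₁, hs₂]
  · rw [lintegral_add_measure, lintegral_smul_measure, lintegral_smul_measure]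
    simp only [ENNReal.smul_def, smul_eq_mul]
    calc _ ≤ (s : ℝ≥0∞) * ENNReal.ofReal (ε k ^ p) + t * ENNReal.ofReal (ε k ^ p) := by
          gcongr
          exacts [hk₁ k, hk₂ k]
      _ = _ := by rw [← add_mul, hst', one_mul]

variable [∀ k, BorelSpace (E k)] [∀ k, ProperSpace (E k)]

/-- A continuous function with growth of order at most `p` has uniformly bounded first absolute
moments over the hyperrectangle. -/
theorem exists_integral_abs_le {ρ : Ξ → Ξ → ℝ} (hρE : EquivProductDist ρ) {r p : ℝ} (hr : 0 ≤ r)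
    (hrp : r ≤ p) (hp : 0 < p) {Q : Measure Ξ} (hQ : FiniteMoment ρ p Q) (ε : Fin n → ℝ)
    {h : Ξ → ℝ} (hc : Continuous h) (hh : Growth ρ r h) :
    ∃ B : ℝ, 0 ≤ B ∧ ∀ P ∈ hyperrectangle p Q ε, Integrable h P ∧ ∫ ξ, |h ξ| ∂P ≤ B := by
  obtain ⟨ζ, hζ⟩ := hQ.dist hρE hp.le
  obtain ⟨A, hA, hb⟩ := hh.exists_dist_bound hρE hr hrp ζ
  have h2p : (1 : ℝ) ≤ 2 ^ p := Real.one_le_rpow (by norm_num) hp.le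
  -- Passing through the coupled point `η ∼ Q` splits the bound into the moment of `Q` and the
  -- transport costs; integrating over the coupling gives `K`, independent of `P`.
  have hpt : ∀ η ξ : Ξ, |h ξ| ≤ A * 2 ^ p *
      (1 + dist ζ η ^ p + ∑ k, dist (η.1 k) (ξ.1 k) ^ p) := by
    intro η ξ
    refine (hb ξ).trans ?_
    rw [mul_assoc]
    refine mul_le_mul_of_nonneg_left ?_ hA
    have h1 : dist ζ ξ ^ p ≤ 2 ^ p * (dist ζ η ^ p + dist η ξ ^ p) :=
      (Real.rpow_le_rpow dist_nonneg (dist_triangle ζ η ξ) hp.le).trans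
        (rpow_add_le dist_nonneg dist_nonneg hp.le)
    have h2 := mul_le_mul_of_nonneg_left (dist_rpow_le_sum hp η ξ) (zero_le_one.trans h2p)
    linarith
  set K : ℝ≥0∞ := ENNReal.ofReal (A * 2 ^ p) *
    (1 + ∫⁻ η, ENNReal.ofReal (dist ζ η ^ p) ∂Q + ∑ k, ENNReal.ofReal (ε k ^ p)) with hKdef
  have hK : K ≠ ∞ := by
    refine ENNReal.mul_ne_top ENNReal.ofReal_ne_top (ENNReal.add_ne_top.2
      ⟨ENNReal.add_ne_top.2 ⟨ENNReal.one_ne_top, hζ.ne⟩, ?_⟩)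
    exact ENNReal.sum_ne_top.2 fun k _ => ENNReal.ofReal_ne_top
  have hmeas : ∀ k, Measurable fun z : Ξ × Ξ => ENNReal.ofReal (dist (z.1.1 k) (z.2.1 k) ^ p) := by
    intro k
    exact ENNReal.measurable_ofReal.comp (Measurable.pow_const (Measurable.dist
      ((measurable_pi_apply k).comp (measurable_subtype_coe.comp measurable_fst))
      ((measurable_pi_apply k).comp (measurable_subtype_coe.comp measurable_snd))) p)
  have hmeas' : Measurable fun η : Ξ => ENNReal.ofReal (dist ζ η ^ p) :=
    ENNReal.measurable_ofReal.comp (Measurable.pow_const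
      (continuous_const.dist continuous_id).measurable p)
  refine ⟨K.toReal, ENNReal.toReal_nonneg, fun P hP => ?_⟩
  have hlin : ∫⁻ ξ, ‖h ξ‖ₑ ∂P ≤ K := by
    obtain ⟨π, hπ, rfl, rfl, hk⟩ := hP
    rw [lintegral_map hc.measurable.enorm measurable_snd]
    calc ∫⁻ z : Ξ × Ξ, ‖h z.2‖ₑ ∂π
        ≤ ∫⁻ z : Ξ × Ξ, ENNReal.ofReal (A * 2 ^ p) * (1 + ENNReal.ofReal (dist ζ z.1 ^ p) +
            ∑ k, ENNReal.ofReal (dist (z.1.1 k) (z.2.1 k) ^ p)) ∂π := by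
          refine lintegral_mono fun z => ?_
          rw [Real.enorm_eq_ofReal_abs, ← ENNReal.ofReal_sum_of_nonneg (fun k _ => by positivity),
            ← ENNReal.ofReal_one, ← ENNReal.ofReal_add zero_le_one (by positivity),
            ← ENNReal.ofReal_add (by positivity)
              (Finset.sum_nonneg fun k _ => by positivity),
            ← ENNReal.ofReal_mul (by positivity)]
          exact ENNReal.ofReal_le_ofReal (hpt z.1 z.2)
      _ = ENNReal.ofReal (A * 2 ^ p) * (1 + ∫⁻ z, ENNReal.ofReal (dist ζ z.1 ^ p) ∂π +
            ∑ k, ∫⁻ z : Ξ × Ξ, ENNReal.ofReal (dist (z.1.1 k) (z.2.1 k) ^ p) ∂π) := by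
          rw [lintegral_const_mul' _ _ ENNReal.ofReal_ne_top,
            lintegral_add_right _ (Finset.measurable_fun_sum _ fun k _ => hmeas k),
            lintegral_add_left measurable_const,
            lintegral_finsetSum _ fun k _ => hmeas k]
          simp
      _ ≤ K := by
          rw [hKdef, lintegral_map hmeas' measurable_fst]
          gcongr with k _
          exact hk k
  have hint : Integrable h P :=
    ⟨hc.measurable.aestronglyMeasurable, hlin.trans_lt hK.lt_top⟩
  refine ⟨hint, ?_⟩
  have := ENNReal.toReal_mono hK hlin
  rwa [← integral_norm_eq_lintegral_enorm hint.1] at this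

end Transport

/-! ### The objective as a function of `τ`. -/

section Objective

variable {X : Type*} [MeasurableSpace X] {h : X → ℝ} {P : Measure X}

theorem integrable_cvarObjective [IsFiniteMeasure P] (hh : Integrable h P) (α τ : ℝ) :
    Integrable (fun ξ => max (h ξ + τ) 0 - τ * α) P :=
  (hh.add (integrable_const τ)).pos_part.sub (integrable_const _)

theorem convexOn_cvarObjective [IsFiniteMeasure P] (hh : Integrable h P) (α : ℝ) :
    ConvexOn ℝ Set.univ fun τ => cvarObjective h α τ P := by
  refine ⟨convex_univ, fun s _ t _ a b ha hb hab => ?_⟩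
  have hs := integrable_cvarObjective hh α s
  have ht := integrable_cvarObjective hh α t
  simp only [cvarObjective, smul_eq_mul]
  rw [← integral_const_mul, ← integral_const_mul,
    ← integral_add (hs.const_mul a) (ht.const_mul b)]
  refine integral_mono (integrable_cvarObjective hh α _)
    ((hs.const_mul a).add (ht.const_mul b)) fun ξ => ?_
  have h1 : max (h ξ + (a * s + b * t)) 0 ≤ a * max (h ξ + s) 0 + b * max (h ξ + t) 0 := by
    refine max_le ?_ (by positivity)
    have e : h ξ + (a * s + b * t) = a * (h ξ + s) + b * (h ξ + t) := by
      linear_combination (-h ξ) * hab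
    rw [e]
    gcongr <;> exact le_max_left _ _
  simp only
  linarith

theorem cvarObjective_convexComb {P₁ P₂ : Measure X} [IsFiniteMeasure P₁] [IsFiniteMeasure P₂]
    (h₁ : Integrable h P₁) (h₂ : Integrable h P₂) (α τ : ℝ) (s t : NNReal) :
    cvarObjective h α τ (s • P₁ + t • P₂) =
      s * cvarObjective h α τ P₁ + t * cvarObjective h α τ P₂ := by
  unfold cvarObjective
  rw [integral_add_measure (integrable_cvarObjective h₁ α τ).smul_measure_nnreal
    (integrable_cvarObjective h₂ α τ).smul_measure_nnreal, integral_smul_nnreal_measure,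
    integral_smul_nnreal_measure]
  rfl

variable [IsProbabilityMeasure P] {B : ℝ}

theorem cvarObjective_zero_le (hh : Integrable h P) (hB : ∫ ξ, |h ξ| ∂P ≤ B) (α : ℝ) :
    cvarObjective h α 0 P ≤ B := by
  refine le_trans (integral_mono (integrable_cvarObjective hh α 0) hh.abs fun ξ => ?_) hB
  simp [le_abs_self]

/-- From `y₊ ≥ 0`; this controls `τ → -∞`, while `y₊ ≥ y` in `sub_le_cvarObjective` controls `τ →
∞`. -/
theorem neg_mul_le_cvarObjective (hh : Integrable h P) (α τ : ℝ) :
    -(τ * α) ≤ cvarObjective h α τ P := by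
  have := integral_mono (integrable_const (-(τ * α))) (integrable_cvarObjective hh α τ)
    fun ξ => by simp
  simpa [cvarObjective] using this

theorem sub_le_cvarObjective (hh : Integrable h P) (hB : ∫ ξ, |h ξ| ∂P ≤ B) (α τ : ℝ) :
    τ * (1 - α) - B ≤ cvarObjective h α τ P := by
  have h1 : ∫ ξ, (τ * (1 - α) - |h ξ|) ∂P ≤ cvarObjective h α τ P :=
    integral_mono ((integrable_const _).sub hh.abs) (integrable_cvarObjective hh α τ) fun ξ => by
      have := le_max_left (h ξ + τ) 0
      have := neg_abs_le (h ξ)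
      simp only
      linarith
  rw [integral_sub (integrable_const _) hh.abs] at h1
  simp only [integral_const, probReal_univ, one_smul] at h1
  linarith

end Objective

end MTH

/-- The suprema and infima are taken in `EReal`; the first two conjuncts say that every
expectation is that of an integrable function and that the optimal values are real numbers. -/
theorem mainTheorem8 {n ℓ : ℕ} {E : Fin n → Type*} [∀ k, MetricSpace (E k)]
    [∀ k, ProperSpace (E k)] [∀ k, MeasurableSpace (E k)] [∀ k, BorelSpace (E k)]
    (Ξ : Set (∀ k, E k)) (hΞ : IsClosed Ξ)
    (ρ : Ξ → Ξ → ℝ) (hρ : MTH.IsMetric ρ) (hρE : MTH.EquivProductDist ρ)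
    (p : ℝ) (hp : 1 ≤ p)
    (Q : Measure Ξ) [IsProbabilityMeasure Q] (hQ : MTH.FiniteMoment ρ p Q)
    (ε : Fin n → ℝ) (hε : ∀ k, 0 ≤ ε k)
    (α : ℝ) (hα : α ∈ Set.Ioo (0 : ℝ) 1)
    (𝒳 : Set (EuclideanSpace ℝ (Fin ℓ))) (h𝒳 : IsClosed 𝒳) (h𝒳c : Convex ℝ 𝒳)
    (f : EuclideanSpace ℝ (Fin ℓ) → Ξ → ℝ) (hf : MTH.IsConstraintFunction 𝒳 ρ p f)
    (x : EuclideanSpace ℝ (Fin ℓ)) (hx : x ∈ 𝒳) :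
    (∀ P ∈ MTH.hyperrectangle p Q ε, ∀ τ : ℝ,
      Integrable (fun ξ => max (f x ξ + τ) 0 - τ * α) P) ∧
    (∃ v : ℝ, (⨅ τ : ℝ, ⨆ P ∈ MTH.hyperrectangle p Q ε,
      (MTH.cvarObjective (f x) α τ P : EReal)) = v) ∧
    (⨆ P ∈ MTH.hyperrectangle p Q ε, ⨅ τ : ℝ, (MTH.cvarObjective (f x) α τ P : EReal)) =
      (⨅ τ : ℝ, ⨆ P ∈ MTH.hyperrectangle p Q ε, (MTH.cvarObjective (f x) α τ P : EReal)) ∧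
    ∃ τ₀ : ℝ, (⨆ P ∈ MTH.hyperrectangle p Q ε, (MTH.cvarObjective (f x) α τ₀ P : EReal)) =
      ⨅ τ : ℝ, ⨆ P ∈ MTH.hyperrectangle p Q ε, (MTH.cvarObjective (f x) α τ P : EReal) := by
  obtain ⟨r, hr, hrp, hfx⟩ := hf.growth
  obtain ⟨hcont, hgr⟩ := hfx x hx
  have hp0 : 0 < p := by linarith
  obtain ⟨hα0, hα1⟩ := hα
  have h1α : 0 < 1 - α := by linarith
  obtain ⟨B, hB0, hB⟩ := MTH.exists_integral_abs_le hρE hr hrp.le hp0 hQ ε hcont hgr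
  have hprob : ∀ P ∈ MTH.hyperrectangle p Q ε, IsProbabilityMeasure P := fun P hP =>
    MTH.isProbabilityMeasure_of_mem_hyperrectangle hP
  have hQmem : Q ∈ MTH.hyperrectangle p Q ε := MTH.self_mem_hyperrectangle hp0 ε
  set S := MTH.hyperrectangle p Q ε with hS
  let G : Measure Ξ → ℝ → ℝ := fun P τ => MTH.cvarObjective (f x) α τ P
  have hconvY : Convex ℝ (G '' S) := by
    rintro _ ⟨P₁, h₁, rfl⟩ _ ⟨P₂, h₂, rfl⟩ s t hs ht hst
    lift s to NNReal using hs
    lift t to NNReal using ht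
    have := hprob P₁ h₁
    have := hprob P₂ h₂
    exact ⟨s • P₁ + t • P₂,
      MTH.convexComb_mem_hyperrectangle h₁ h₂ (by exact_mod_cast hst),
      funext fun τ => MTH.cvarObjective_convexComb (hB P₁ h₁).1 (hB P₂ h₂).1 α τ s t⟩
  have hconv : ∀ g ∈ G '' S, ConvexOn ℝ Set.univ g := by
    rintro _ ⟨P, hP, rfl⟩
    have := hprob P hP
    exact MTH.convexOn_cvarObjective (hB P hP).1 α
  -- `-τα ≥ B` once `τ ≤ -B/α`, and `τ(1 - α) - B ≥ B` once `τ ≥ 2B/(1 - α)`; the sum of the two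
  -- thresholds serves both sides.
  have hcoer : ∀ g ∈ G '' S, ∀ τ,
      τ ∉ Set.Icc (-(B / α + 2 * B / (1 - α))) (B / α + 2 * B / (1 - α)) → g 0 ≤ g τ := by
    rintro _ ⟨P, hP, rfl⟩ τ hτ
    have := hprob P hP
    refine (MTH.cvarObjective_zero_le (hB P hP).1 (hB P hP).2 α).trans ?_
    have hn1 : 0 ≤ B / α := by positivity
    have hn2 : 0 ≤ 2 * B / (1 - α) := by positivity
    rcases not_and_or.1 hτ with h | h
    · refine le_trans ?_ (MTH.neg_mul_le_cvarObjective (hB P hP).1 α τ)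
      have h' : B / α ≤ -τ := by linarith
      rw [div_le_iff₀ hα0] at h'
      linarith
    · refine le_trans ?_ (MTH.sub_le_cvarObjective (hB P hP).1 (hB P hP).2 α τ)
      have h' : 2 * B / (1 - α) ≤ τ := by linarith
      rw [div_le_iff₀ h1α] at h'
      linarith
  have hmm := MTH.minimax_of_coercive hconvY hconv (by positivity) hcoer
  simp only [iSup_image] at hmm
  refine ⟨fun P hP τ => ?_, ?_, hmm.1, hmm.2⟩
  · have := hprob P hP
    exact MTH.integrable_cvarObjective (hB P hP).1 α τ
  · have hupper : (⨅ τ : ℝ, ⨆ P ∈ S, (MTH.cvarObjective (f x) α τ P : EReal)) ≤ (B : EReal) := by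
      refine (iInf_le _ 0).trans (iSup₂_le fun P hP => ?_)
      have := hprob P hP
      exact EReal.coe_le_coe_iff.2 (MTH.cvarObjective_zero_le (hB P hP).1 (hB P hP).2 α)
    -- Test with `P = Q`; the sign of `τ` decides which linear minorant is at least `-B`.
    have hlower : ((-B : ℝ) : EReal) ≤
        ⨅ τ : ℝ, ⨆ P ∈ S, (MTH.cvarObjective (f x) α τ P : EReal) := by
      refine le_iInf fun τ => le_iSup₂_of_le Q hQmem (EReal.coe_le_coe_iff.2 ?_)
      have hQi := hB Q hQmem
      rcases le_total 0 τ with h | h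
      · have h1 := MTH.sub_le_cvarObjective hQi.1 hQi.2 α τ
        have h2 := mul_nonneg h h1α.le
        linarith
      · have h1 := MTH.neg_mul_le_cvarObjective hQi.1 α τ
        have h2 := mul_nonneg (neg_nonneg.2 h) hα0.le
        linarith
    exact ⟨_, (EReal.coe_toReal (ne_top_of_le_ne_top (EReal.coe_ne_top B) hupper)
      (ne_bot_of_le_ne_bot (EReal.coe_ne_bot (-B)) hlower)).symm⟩
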